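/- Let $M_N$ be the set of complex $N\times N$ matrices and let $D(N)\subseteq M_N$ be the set of density matrices, i.e. positive semidefinite matrices of trace $1$. Write a matrix $\rho\in D(m\cdot n)$ in block form $\rho=(\rho_{ij})_{1\le i,j\le m}$ with $\rho_{ij}\in M_n$, put $\mathrm{tr}_1(\rho)=\rho_{11}+\cdots+\rho_{mm}\in M_n$, and for $\sigma\in D(n)$ let $\mathcal S(\sigma)=\{\rho\in D(m\cdot n):\mathrm{tr}_1(\rho)=\sigma\}$. Eigenvalues are counted with multiplicity. For $x,y\in\mathbb R^N$ write $x\prec y$ ($x$ is majorized by $y$) if the entries of $x$ and of $y$ have the same sum and, for $k=1,\dots,N-1$, the sum of the $k$ largest entries of $x$ is at most the sum of the $k$ largest entries of $y$. **Theorem 4.1.** Suppose $m,n\ge 2$, $\lambda_1\ge\cdots\ge\lambda_n\ge 0$ and $\mu_1\ge\cdots\ge\mu_{mn}\ge 0$ satisfy $\sum_{j=1}^n\lambda_j=1=\sum_{j=1}^{mn}\mu_j$. (a) If there exist $\sigma\in D(n)$ with eigenvalues $\lambda_1,\dots,\lambda_n$ and $\rho\in\mathcal S(\sigma)$ with eigenvalues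 $\mu_1,\dots,\mu_{mn}$, then $$\Bigl(\underbrace{\tfrac{\lambda_1}{m},\dots,\tfrac{\lambda_1}{m}}_{m},\underbrace{\tfrac{\lambda_2}{m},\dots,\tfrac{\lambda_2}{m}}_{m},\dots,\underbrace{\tfrac{\lambda_n}{m},\dots,\tfrac{\lambda_n}{m}}_{m}\Bigr)\prec(\mu_1,\dots,\mu_{mn}),$$ $$(\lambda_1,\dots,\lambda_n)\prec\Bigl(\sum_{j=1}^m\mu_j,\ \sum_{j=1}^m\mu_{m+j},\ \dots,\ \sum_{j=1}^m\mu_{(n-1)m+j}\Bigr),\qquad(1)$$ and, setting $\lambda_j=0$ for $j>n$, $$(\mu_1,\dots,\mu_{mn})\prec\Bigl(\sum_{j=1}^m\lambda_j,\ \sum_{j=1}^m\lambda_{m+j},\ \dots,\ \sum_{j=1}^m\lambda_{(mn-1)m+j}\Bigr).$$ (b) If $m\ge n$ and (1) holds, then there exist $\sigma\in D(n)$ with eigenvalues $\lambda_1,\dots,\lambda_n$ and $\rho\in\mathcal S(\sigma)$ with eigenvalues $\mu_1,\dots,\mu_{mn}$. -/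

import Mathlib

open scoped ComplexOrder

namespace ReducedState

/-- `D(ι)`: the density matrices, i.e. the complex positive semidefinite matrices of trace one. -/
def densityMatrices (ι : Type*) [Fintype ι] : Set (Matrix ι ι ℂ) :=
  {A | A.PosSemidef ∧ A.trace = 1}

/-- The partial trace over the first tensor factor. A matrix of size `m n` is indexed by
`Fin m × Fin n`, so that it is an `m × m` array of blocks `ρ i i'` of size `n × n`, and its
partial trace is the sum of the diagonal blocks. -/
def partialTraceFst {m n : ℕ} (ρ : Matrix (Fin m × Fin n) (Fin m × Fin n) ℂ) :
    Matrix (Fin n) (Fin n) ℂ :=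
  Matrix.of fun a b => ∑ i : Fin m, ρ (i, a) (i, b)

/-- `S(σ)`: the density matrices of size `m n` whose first partial trace is `σ`. -/
def statesWithReduction (m : ℕ) {n : ℕ} (σ : Matrix (Fin n) (Fin n) ℂ) :
    Set (Matrix (Fin m × Fin n) (Fin m × Fin n) ℂ) :=
  {ρ | ρ ∈ densityMatrices (Fin m × Fin n) ∧ partialTraceFst ρ = σ}

/-- The eigenvalues of `A`, counted with algebraic multiplicity, are the entries of `x`. -/
def HasEigenvalues {ι : Type*} [Fintype ι] [DecidableEq ι] (A : Matrix ι ι ℂ)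
    {N : ℕ} (x : Fin N → ℝ) : Prop :=
  A.charpoly.roots = Multiset.map (fun i => (x i : ℂ)) Finset.univ.val

/-- The entries of `x` arranged in descending order. -/
noncomputable def descending {N : ℕ} (x : Fin N → ℝ) : Fin N → ℝ :=
  x ∘ Tuple.sort (fun i => -x i)

/-- The sum of the `k` largest entries of `x`. -/
noncomputable def sumLargest {N : ℕ} (x : Fin N → ℝ) (k : ℕ) : ℝ :=
  ∑ i : Fin N with i.val < k, descending x i

/-- `x ≺ y`: the vector `x` is majorized by the vector `y`. -/
def MajorizedBy {N : ℕ} (x y : Fin N → ℝ) : Prop :=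
  ∑ i, x i = ∑ i, y i ∧ ∀ k : ℕ, 1 ≤ k → k < N → sumLargest x k ≤ sumLargest y k

/-- The sum of the `k`-th block (counted from `k = 0`) of `m` consecutive entries of `x`, where
`x` is extended by zeros beyond its last entry. -/
def blockSum (m : ℕ) {N : ℕ} (x : Fin N → ℝ) (k : ℕ) : ℝ :=
  ∑ j : Fin m, if h : k * m + j.val < N then x ⟨k * m + j.val, h⟩ else 0

/-- The vector of length `m n` in which every entry of `x` is divided by `m` and repeated
`m` times in a row. -/
noncomputable def repeatDiv (m : ℕ) {n : ℕ} (x : Fin n → ℝ) : Fin (m * n) → ℝ :=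
  fun i => x ⟨i.val / m, Nat.div_lt_of_lt_mul i.isLt⟩ / m

end ReducedState

namespace ReducedState

/-! Part (a) rests on Ky Fan's bound (`HasEigenvalues.re_trace_mul_le`): if `0 ≤ P ≤ 1` and `tr P ≤
k`, then `tr (A P)` is at most the sum of the `k` largest eigenvalues of `A`. The partial trace is
dual to `P ↦ 1 ⊗ P`, which multiplies traces by `m`; taking `P` diagonal in an eigenbasis of `σ`
gives the first two majorizations. For the third, the part of `ρ` on `k` leading eigenvectors has a
partial trace of rank at most `k m`, and the bound is applied to `σ` with its support projection.

Part (b): by Schur–Horn, some orthogonal `U` makes `lam` the diagonal of `U diag(b) Uᵀ`, with `b`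
the block sums of `mu`. The vectors `∑ c, U c a • e (i + c) ⊗ e c`, with `i + c` taken mod `m`, are
orthonormal. Since `n ≤ m`, distinct `c` give distinct shifts, so giving the `(i, a)`-th vector the
`i`-th eigenvalue of block `a` makes the partial trace exactly `diag(lam)`. -/

/-! ### Sums of largest entries and block sums. -/

theorem sum_mul_le_sum_lt {N : ℕ} {x w : Fin N → ℝ} (hx : Antitone x) (hx0 : ∀ i, 0 ≤ x i)
    (hw0 : ∀ i, 0 ≤ w i) (hw1 : ∀ i, w i ≤ 1) {k : ℕ} (hw : ∑ i, w i ≤ k) :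
    ∑ i, w i * x i ≤ ∑ i with i.val < k, x i := by
  rw [Finset.sum_filter]
  rcases lt_or_ge k N with hk | hk
  · set c := x ⟨k, hk⟩ with hc
    -- With threshold `c = x k`, the factors `w i - 1_{i<k}` and `x i - c` never have the same
    -- strict sign.
    have hterm : ∀ i : Fin N, w i * x i - (if i.val < k then x i else 0)
        ≤ c * (w i - if i.val < k then 1 else 0) := by
      intro i
      split_ifs with h
      · have : c ≤ x i := hx (Fin.mk_le_mk.2 h.le)
        nlinarith [hw1 i]
      · have : x i ≤ c := hx (Fin.mk_le_mk.2 (not_lt.1 h))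
        nlinarith [hw0 i]
    have hsum := Finset.sum_le_sum fun i (_ : i ∈ Finset.univ) => hterm i
    rw [Finset.sum_sub_distrib, ← Finset.mul_sum, Finset.sum_sub_distrib] at hsum
    have hcard : ∑ i : Fin N, (if i.val < k then (1 : ℝ) else 0) = k := by
      rw [Fin.sum_univ_eq_sum_range (fun i => if i < k then (1 : ℝ) else 0), ← Finset.sum_filter]
      have : (Finset.range N).filter (· < k) = Finset.range k := by
        ext i; simp; omega
      simp [this]
    rw [hcard] at hsum
    have : c * (∑ i, w i - k) ≤ 0 := mul_nonpos_of_nonneg_of_nonpos (hx0 _) (by linarith)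
    linarith
  · refine Finset.sum_le_sum fun i _ => ?_
    rw [if_pos (i.isLt.trans_le hk)]
    nlinarith [hw1 i, hx0 i]

theorem descending_of_antitone {N : ℕ} {x : Fin N → ℝ} (hx : Antitone x) : descending x = x := by
  have : Tuple.sort (fun i => -x i) = Equiv.refl _ :=
    Tuple.sort_eq_refl_iff_monotone.2 fun i j h => neg_le_neg (hx h)
  simp [descending, this]

theorem sumLargest_of_antitone {N : ℕ} {x : Fin N → ℝ} (hx : Antitone x) (k : ℕ) :
    sumLargest x k = ∑ i with i.val < k, x i := by
  rw [sumLargest, descending_of_antitone hx]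

/-- The extension of a vector by zeros beyond its last entry. -/
noncomputable def extendZero {N : ℕ} (x : Fin N → ℝ) (j : ℕ) : ℝ :=
  if h : j < N then x ⟨j, h⟩ else 0

theorem extendZero_val {N : ℕ} (x : Fin N → ℝ) (i : Fin N) : extendZero x i = x i := by
  simp [extendZero]

theorem extendZero_antitone {N : ℕ} {x : Fin N → ℝ} (hx : Antitone x) (hx0 : ∀ i, 0 ≤ x i) :
    Antitone (extendZero x) := by
  intro a b hab
  unfold extendZero
  split_ifs with h1 h2 h2
  · exact hx (Fin.mk_le_mk.2 hab)
  · omega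
  · exact hx0 _
  · exact le_rfl

theorem blockSum_eq (m : ℕ) {N : ℕ} (x : Fin N → ℝ) (k : ℕ) :
    blockSum m x k = ∑ j ∈ Finset.range m, extendZero x (k * m + j) := by
  rw [← Fin.sum_univ_eq_sum_range (fun j => extendZero x (k * m + j))]
  rfl

theorem blockSum_antitone (m : ℕ) {N : ℕ} {x : Fin N → ℝ} (hx : Antitone x)
    (hx0 : ∀ i, 0 ≤ x i) : Antitone (blockSum m x) := by
  intro a b hab
  simp only [blockSum_eq]
  exact Finset.sum_le_sum fun j _ => extendZero_antitone hx hx0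
    (Nat.add_le_add_right (Nat.mul_le_mul_right _ hab) _)

theorem sum_range_blockSum (m : ℕ) {N : ℕ} (x : Fin N → ℝ) (k : ℕ) :
    ∑ c ∈ Finset.range k, blockSum m x c = ∑ j ∈ Finset.range (k * m), extendZero x j := by
  induction k with
  | zero => simp
  | succ k ih => rw [Finset.sum_range_succ, ih, Nat.succ_mul, Finset.sum_range_add, blockSum_eq]

theorem sum_lt_eq_sum_range {N : ℕ} (f : ℕ → ℝ) {k : ℕ} (hk : k ≤ N) :
    ∑ i : Fin N with i.val < k, f i = ∑ j ∈ Finset.range k, f j := by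
  rw [Finset.sum_filter, Fin.sum_univ_eq_sum_range (fun i => if i < k then f i else 0),
    ← Finset.sum_filter]
  congr 1
  ext i
  simp
  omega

theorem sum_range_extendZero {N : ℕ} (x : Fin N → ℝ) (k : ℕ) :
    ∑ j ∈ Finset.range k, extendZero x j = ∑ i with i.val < k, x i := by
  rcases le_total k N with hk | hk
  · rw [← sum_lt_eq_sum_range _ hk]
    simp [extendZero_val]
  · rw [← Finset.sum_subset (Finset.range_mono hk), ← Fin.sum_univ_eq_sum_range, Finset.sum_filter]
    · exact Finset.sum_congr rfl fun i _ => by rw [extendZero_val, if_pos (i.isLt.trans_le hk)]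
    · intro j _ hj
      simp only [Finset.mem_range] at hj
      simp [extendZero, hj]

theorem sum_lt_blockSum (m : ℕ) {M N : ℕ} (x : Fin N → ℝ) {k : ℕ} (hk : k ≤ M) :
    ∑ c : Fin M with c.val < k, blockSum m x c = ∑ i with i.val < k * m, x i := by
  rw [sum_lt_eq_sum_range _ hk, sum_range_blockSum, sum_range_extendZero]

theorem sum_blockSum (m : ℕ) {M N : ℕ} (x : Fin N → ℝ) (h : N ≤ M * m) :
    ∑ c : Fin M, blockSum m x c = ∑ i, x i := by
  have := sum_lt_blockSum m x (le_refl M)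
  rwa [Finset.filter_true_of_mem fun c _ => c.isLt,
    Finset.filter_true_of_mem fun i _ => i.isLt.trans_le h] at this

theorem sumLargest_blockSum (m : ℕ) {M N : ℕ} {x : Fin N → ℝ} (hx : Antitone x)
    (hx0 : ∀ i, 0 ≤ x i) {k : ℕ} (hk : k ≤ M) :
    sumLargest (fun c : Fin M => blockSum m x c) k = ∑ i with i.val < k * m, x i := by
  rw [sumLargest_of_antitone fun a b h => blockSum_antitone m hx hx0 h, sum_lt_blockSum m x hk]

/-- The position of the `i`-th entry of the `a`-th block of length `m`. -/
def blockEquiv (m n : ℕ) : Fin m × Fin n ≃ Fin (m * n) :=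
  (Equiv.prodComm _ _).trans (finProdFinEquiv.trans (finCongr (Nat.mul_comm n m)))

theorem blockEquiv_val {m n : ℕ} (i : Fin m) (a : Fin n) :
    (blockEquiv m n (i, a)).val = a.val * m + i.val := by
  simp [blockEquiv, finProdFinEquiv]
  ring

theorem blockSum_eq_sum_blockEquiv {m n : ℕ} (x : Fin (m * n) → ℝ) (a : Fin n) :
    blockSum m x a = ∑ i : Fin m, x (blockEquiv m n (i, a)) := by
  refine Finset.sum_congr rfl fun i _ => ?_
  have h := (blockEquiv m n (i, a)).isLt
  rw [blockEquiv_val] at h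
  rw [dif_pos h]
  exact congrArg x (Fin.ext (blockEquiv_val i a).symm)

theorem repeatDiv_blockEquiv {m n : ℕ} (x : Fin n → ℝ) (i : Fin m) (a : Fin n) :
    repeatDiv m x (blockEquiv m n (i, a)) = x a / m := by
  have hm : 0 < m := i.pos
  have : (blockEquiv m n (i, a)).val / m = a.val := by
    rw [blockEquiv_val, Nat.add_comm, Nat.add_mul_div_right _ _ hm, Nat.div_eq_of_lt i.isLt,
      Nat.zero_add]
  unfold repeatDiv
  congr 2
  exact Fin.ext this

theorem repeatDiv_antitone (m : ℕ) {n : ℕ} {x : Fin n → ℝ} (hx : Antitone x) :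
    Antitone (repeatDiv m x) := fun _ _ h =>
  div_le_div_of_nonneg_right (hx (Fin.mk_le_mk.2 (Nat.div_le_div_right h))) (Nat.cast_nonneg m)

theorem sum_repeatDiv {m n : ℕ} (hm : m ≠ 0) (x : Fin n → ℝ) :
    ∑ i, repeatDiv m x i = ∑ a, x a := by
  rw [← (blockEquiv m n).sum_comp, Fintype.sum_prod_type]
  simp only [repeatDiv_blockEquiv, Finset.sum_const, Finset.card_univ, Fintype.card_fin,
    nsmul_eq_mul]
  rw [← Finset.sum_div]
  field_simp

/-! ### Schur–Horn by plane rotations. -/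

/-- The diagonal of `U diag(b) Uᵀ` for some orthogonal matrix `U` is `y`. -/
def IsDiagonalOfConj {ι : Type*} [Fintype ι] [DecidableEq ι] (b y : ι → ℝ) : Prop :=
  ∃ U : Matrix ι ι ℝ, U * U.transpose = 1 ∧ ∀ c, ∑ a, U c a ^ 2 * b a = y c

theorem IsDiagonalOfConj.refl {ι : Type*} [Fintype ι] [DecidableEq ι] (b : ι → ℝ) :
    IsDiagonalOfConj b b := by
  refine ⟨1, by simp, fun c => ?_⟩
  simp [Matrix.one_apply]

/-- Rotating rows `i` and `j` of `U` by `θ` affects only these two diagonal entries and keeps their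
sum. The angles `0` and `π/2` give `y i` and `y j` at place `i`, so every value between occurs. -/
theorem IsDiagonalOfConj.transfer {ι : Type*} [Fintype ι] [DecidableEq ι] {b y : ι → ℝ}
    (h : IsDiagonalOfConj b y) {i j : ι} (hij : i ≠ j) {t : ℝ} (ht : t ∈ Set.Icc (y j) (y i)) :
    IsDiagonalOfConj b (Function.update (Function.update y i t) j (y i + y j - t)) := by
  obtain ⟨U, hU, hy⟩ := h
  have hdot : ∀ a c, ∑ e, U a e * U c e = if a = c then 1 else 0 := fun a c => by
    have := congrFun (congrFun hU a) c
    simpa [Matrix.mul_apply, Matrix.one_apply] using this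
  let f : ℝ → ℝ := fun θ => ∑ a, (Real.cos θ * U i a + Real.sin θ * U j a) ^ 2 * b a
  have hf : ContinuousOn f (Set.Icc 0 (Real.pi / 2)) := by
    apply Continuous.continuousOn; fun_prop
  have hf0 : f 0 = y i := by simp [f, hy]
  have hf1 : f (Real.pi / 2) = y j := by simp [f, hy]
  obtain ⟨θ, -, hθ⟩ := intermediate_value_Icc' (by positivity) hf (by rwa [hf0, hf1])
  have hcs := Real.sin_sq_add_cos_sq θ
  let V : Matrix ι ι ℝ := fun a => if a = i then Real.cos θ • U i + Real.sin θ • U j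
    else if a = j then Real.cos θ • U j - Real.sin θ • U i else U a
  have hVi : V i = Real.cos θ • U i + Real.sin θ • U j := by simp [V]
  have hVj : V j = Real.cos θ • U j - Real.sin θ • U i := by simp [V, hij.symm]
  have hVa : ∀ a, a ≠ i → a ≠ j → V a = U a := fun a h1 h2 => by simp [V, h1, h2]
  have hdot' : ∀ a c, U a ⬝ᵥ U c = if a = c then 1 else 0 := hdot
  refine ⟨V, ?_, fun c => ?_⟩
  · ext a c
    change V a ⬝ᵥ V c = _
    rw [Matrix.one_apply]
    rcases eq_or_ne a i with rfl | hai
    · rcases eq_or_ne c a with rfl | hca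
      · simp [hVi, hdot', hij, hij.symm]; nlinarith
      · rcases eq_or_ne c j with rfl | hcj
        · simp [hVi, hVj, hdot', hij, hij.symm]; ring
        · simp [hVi, hVa c hca hcj, hdot', hca.symm, hcj.symm]
    · rcases eq_or_ne a j with rfl | haj
      · rcases eq_or_ne c i with rfl | hci
        · simp [hVi, hVj, hdot', hij, hij.symm]; ring
        · rcases eq_or_ne c a with rfl | hca
          · simp [hVj, hdot', hij, hij.symm]; nlinarith
          · simp [hVj, hVa c hci hca, hdot', hca.symm, hci.symm]
      · rw [hVa a hai haj]
        rcases eq_or_ne c i with rfl | hci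
        · simp [hVi, hdot', hai, haj]
        · rcases eq_or_ne c j with rfl | hcj
          · simp [hVj, hdot', hai, haj]
          · simp [hVa c hci hcj, hdot']
  · rcases eq_or_ne c j with rfl | hcj
    · rw [Function.update_self, hVj, ← hθ, ← hy, ← hy, ← Finset.sum_add_distrib,
        ← Finset.sum_sub_distrib]
      refine Finset.sum_congr rfl fun a _ => ?_
      simp only [Pi.sub_apply, Pi.smul_apply, smul_eq_mul]
      linear_combination (U i a ^ 2 + U c a ^ 2) * b a * hcs
    · rw [Function.update_of_ne hcj]
      rcases eq_or_ne c i with rfl | hci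
      · rw [Function.update_self, hVi, ← hθ]; simp [f]
      · rw [Function.update_of_ne hci, hVa c hci hcj, hy]

/-- One direction of the Schur–Horn theorem, for a vector whose initial sums are dominated. -/
theorem IsDiagonalOfConj.of_sum_lt_le {n : ℕ} {b x : Fin n → ℝ} (hx : Antitone x) :
    ∀ {y : Fin n → ℝ}, IsDiagonalOfConj b y → ∑ i, x i = ∑ i, y i →
      (∀ k : ℕ, ∑ i with i.val < k, x i ≤ ∑ i with i.val < k, y i) → IsDiagonalOfConj b x := by
  intro y
  -- Induction on the number of places where `y` differs from `x`.
  induction hc : (Finset.univ.filter fun i => y i ≠ x i).card using Nat.strong_induction_on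
    generalizing y with
  | _ N ih =>
  intro hy hsum hdom
  by_cases hall : ∀ i, x i ≤ y i
  · have := (Finset.sum_eq_sum_iff_of_le fun i _ => hall i).1 hsum
    rwa [show x = y from funext fun i => this i (Finset.mem_univ i)]
  push Not at hall
  -- `k` is the first place where `y` falls short; domination of the initial sum through `k` forces
  -- an excess at some `j < k`.
  obtain ⟨k, hk, hmin⟩ : ∃ k, y k < x k ∧ ∀ i < k, x i ≤ y i := by
    obtain ⟨k, hk, hm⟩ := wellFounded_lt.has_min {i | y i < x i} hall
    exact ⟨k, hk, fun i hi => not_lt.1 fun h => hm i h hi⟩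
  obtain ⟨j, hjk, hj⟩ : ∃ j < k, x j < y j := by
    by_contra! hcon
    have := hdom (k.val + 1)
    refine absurd this (not_le.2 (Finset.sum_lt_sum (fun i hi => ?_) ⟨k, by simp, hk⟩))
    simp only [Finset.mem_filter, Finset.mem_univ, true_and] at hi
    rcases (Nat.lt_succ_iff.1 hi).lt_or_eq with h | h
    · exact hcon i h
    · rw [Fin.ext h]; exact hk.le
  -- The largest transfer from `j` to `k` that overshoots neither target; it makes one of the two
  -- entries correct.
  set δ := min (y j - x j) (x k - y k) with hδ
  have hδ1 : δ ≤ y j - x j := min_le_left _ _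
  have hδ2 : δ ≤ x k - y k := min_le_right _ _
  have hδ0 : 0 < δ := lt_min (by linarith) (by linarith)
  -- Monotonicity gives `y j - δ ≥ x j ≥ x k > y k`, so the new value lies in the range reachable by
  -- a rotation.
  have hxjk := hx hjk.le
  set y' := Function.update (Function.update y j (y j - δ)) k (y j + y k - (y j - δ)) with hy'
  have hy'k : y' k = y k + δ := by rw [hy', Function.update_self]; ring
  have hy'j : y' j = y j - δ := by
    rw [hy', Function.update_of_ne hjk.ne, Function.update_self]
  have hy'a : ∀ a, a ≠ j → a ≠ k → y' a = y a := fun a h1 h2 => by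
    rw [hy', Function.update_of_ne h2, Function.update_of_ne h1]
  have hsum' : ∀ s : Finset (Fin n), j ∈ s → k ∈ s → ∑ i ∈ s, y' i = ∑ i ∈ s, y i := by
    intro s hjs hks
    have hks' : k ∈ s.erase j := Finset.mem_erase.2 ⟨hjk.ne', hks⟩
    rw [← Finset.add_sum_erase s y' hjs, ← Finset.add_sum_erase s y hjs,
      ← Finset.add_sum_erase _ y' hks', ← Finset.add_sum_erase _ y hks', hy'j, hy'k]
    rw [Finset.sum_congr rfl fun a ha => hy'a a (Finset.mem_erase.1 (Finset.mem_erase.1 ha).2).1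
      (Finset.mem_erase.1 ha).1]
    ring
  have htrans : IsDiagonalOfConj b y' := hy.transfer hjk.ne ⟨by linarith, by linarith⟩
  clear_value y'
  refine ih _ ?_ rfl htrans ?_ ?_
  · rw [← hc]
    refine Finset.card_lt_card ((Finset.ssubset_iff_of_subset fun a ha => ?_).2 ?_)
    · simp only [Finset.mem_filter, Finset.mem_univ, true_and] at ha ⊢
      rcases eq_or_ne a j with rfl | h1
      · exact hj.ne'
      rcases eq_or_ne a k with rfl | h2
      · exact hk.ne
      rwa [hy'a a h1 h2] at ha
    · rcases min_choice (y j - x j) (x k - y k) with h | h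
      · refine ⟨j, by simpa using hj.ne', ?_⟩
        simp only [Finset.mem_filter, Finset.mem_univ, true_and, not_not]
        rw [hy'j, hδ, h]; ring
      · refine ⟨k, by simpa using hk.ne, ?_⟩
        simp only [Finset.mem_filter, Finset.mem_univ, true_and, not_not]
        rw [hy'k, hδ, h]; ring
  · rw [hsum, hsum' _ (Finset.mem_univ _) (Finset.mem_univ _)]
  · intro p
    -- Initial sums containing both places are unchanged; those stopping before `k` still dominate
    -- entry by entry.
    rcases lt_or_ge k.val p with hp | hp
    · rw [hsum' _ (by simpa using lt_trans (Fin.lt_def.1 hjk) hp) (by simpa using hp)]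
      exact hdom p
    · refine Finset.sum_le_sum fun i hi => ?_
      simp only [Finset.mem_filter, Finset.mem_univ, true_and] at hi
      have hik : i < k := Fin.lt_def.2 (lt_of_lt_of_le hi hp)
      rcases eq_or_ne i j with rfl | h1
      · rw [hy'j]; linarith
      · rw [hy'a i h1 hik.ne]; exact hmin i hik


/-! ### Spectral decompositions and Ky Fan's bound. -/

open Matrix

/-- Equal multisets have fibres of equal size, and these can be matched. This turns equality of root
multisets into an indexing of eigenvectors by the prescribed eigenvalues. -/
theorem exists_equiv_of_map_univ_eq {ι κ β : Type*} [Fintype ι] [Fintype κ] {f : ι → β}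
    {g : κ → β} (h : Multiset.map f Finset.univ.val = Multiset.map g Finset.univ.val) :
    ∃ e : ι ≃ κ, ∀ i, f i = g (e i) := by
  classical
  have hcard : ∀ c, Fintype.card {i // f i = c} = Fintype.card {j // g j = c} := fun c => by
    have := congrArg (Multiset.count c) h
    rw [Multiset.count_map, Multiset.count_map] at this
    rw [Fintype.card_subtype, Fintype.card_subtype]
    simpa [Finset.card, eq_comm] using this
  let e := Equiv.ofFiberEquiv fun c => Fintype.equivOfCardEq (hcard c)
  exact ⟨e, fun i => (Equiv.ofFiberEquiv_map _ i).symm⟩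

section Spectral

variable {ι : Type*} [Fintype ι] [DecidableEq ι] {A : Matrix ι ι ℂ}

theorem exists_unitary_diagonal (hA : A.IsHermitian) :
    ∃ W : Matrix ι ι ℂ, Wᴴ * W = 1 ∧ W * Wᴴ = 1 ∧
      A = W * diagonal (fun i => (hA.eigenvalues i : ℂ)) * Wᴴ := by
  refine ⟨hA.eigenvectorUnitary, ?_, ?_, ?_⟩
  · exact Unitary.coe_star_mul_self _
  · exact Unitary.coe_mul_star_self _
  · conv_lhs => rw [hA.spectral_theorem, Unitary.conjStarAlgAut_apply]
    rfl

theorem HasEigenvalues.exists_unitary (hA : A.IsHermitian) {N : ℕ} {x : Fin N → ℝ}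
    (hx : HasEigenvalues A x) :
    ∃ (W : Matrix ι ι ℂ) (e : ι ≃ Fin N), Wᴴ * W = 1 ∧ W * Wᴴ = 1 ∧
      A = W * diagonal (fun i => (x (e i) : ℂ)) * Wᴴ := by
  have h := hA.roots_charpoly_eq_eigenvalues.symm.trans hx
  obtain ⟨e, he⟩ := exists_equiv_of_map_univ_eq h
  obtain ⟨W, h1, h2, h3⟩ := exists_unitary_diagonal hA
  refine ⟨W, e, h1, h2, ?_⟩
  simp_rw [← he]
  exact h3

theorem hasEigenvalues_conj_diagonal {W : Matrix ι ι ℂ} (hW : Wᴴ * W = 1) {N : ℕ}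
    (x : Fin N → ℝ) (e : ι ≃ Fin N) :
    HasEigenvalues (W * diagonal (fun i => (x (e i) : ℂ)) * Wᴴ) x := by
  rw [HasEigenvalues, charpoly_mul_comm, ← Matrix.mul_assoc, hW, Matrix.one_mul, charpoly_diagonal,
    e.prod_comp (fun i => Polynomial.X - Polynomial.C (x i : ℂ)),
    Polynomial.roots_prod _ _ (Finset.prod_ne_zero_iff.2 fun i _ => Polynomial.X_sub_C_ne_zero _)]
  simp [Multiset.bind_singleton]

theorem posSemidef_conj_diagonal (W : Matrix ι ι ℂ) {d : ι → ℝ} (hd : ∀ i, 0 ≤ d i) :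
    (W * diagonal (fun i => (d i : ℂ)) * Wᴴ).PosSemidef :=
  (PosSemidef.diagonal fun i => by simpa using hd i).mul_mul_conjTranspose_same W

theorem trace_conj_diagonal {W : Matrix ι ι ℂ} (hW : Wᴴ * W = 1) (d : ι → ℂ) :
    (W * diagonal d * Wᴴ).trace = ∑ i, d i := by
  rw [trace_mul_comm, ← Matrix.mul_assoc, hW, Matrix.one_mul, trace_diagonal]

theorem conj_diagonal_mul {W : Matrix ι ι ℂ} (hW : Wᴴ * W = 1) (c d : ι → ℂ) :
    (W * diagonal c * Wᴴ) * (W * diagonal d * Wᴴ) = W * diagonal (fun i => c i * d i) * Wᴴ := by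
  calc _ = W * diagonal c * (Wᴴ * W) * diagonal d * Wᴴ := by simp only [Matrix.mul_assoc]
    _ = _ := by rw [hW, Matrix.mul_one, Matrix.mul_assoc W, diagonal_mul_diagonal]

theorem one_sub_conj_diagonal {W : Matrix ι ι ℂ} (hW : W * Wᴴ = 1) (d : ι → ℝ) :
    1 - W * diagonal (fun i => (d i : ℂ)) * Wᴴ
      = W * diagonal (fun i => ((1 - d i : ℝ) : ℂ)) * Wᴴ := by
  have : diagonal (fun i => ((1 - d i : ℝ) : ℂ)) = 1 - diagonal (fun i => (d i : ℂ)) := by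
    rw [← diagonal_one, diagonal_sub]
    simp
  rw [this, Matrix.mul_sub, Matrix.sub_mul, Matrix.mul_one, hW]

/-- The upper bound of Ky Fan for the trace against a matrix `P` with `0 ≤ P ≤ 1`. -/
theorem HasEigenvalues.re_trace_mul_le (hA : A.IsHermitian) {N : ℕ} {x : Fin N → ℝ}
    (hx : HasEigenvalues A x) (hanti : Antitone x) (hx0 : ∀ i, 0 ≤ x i) {P : Matrix ι ι ℂ}
    (hP : P.PosSemidef) (hP1 : (1 - P).PosSemidef) {k : ℕ} (hk : P.trace.re ≤ k) :
    (A * P).trace.re ≤ ∑ i with i.val < k, x i := by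
  obtain ⟨W, e, h1, h2, h3⟩ := hx.exists_unitary hA
  -- `Q` is `P` in an eigenbasis of `A`: its diagonal lies in `[0, 1]` and has sum `tr P`, so it
  -- serves as the weight vector.
  set Q := Wᴴ * P * W with hQdef
  have hQ : Q.PosSemidef := hP.conjTranspose_mul_mul_same W
  have hQ1 : (1 - Q).PosSemidef := by
    have := hP1.conjTranspose_mul_mul_same W
    rwa [Matrix.mul_sub, Matrix.sub_mul, Matrix.mul_one, h1] at this
  have htr : (A * P).trace = ∑ i, (x (e i) : ℂ) * Q i i := by
    rw [h3, Matrix.mul_assoc, Matrix.mul_assoc, trace_mul_comm, Matrix.mul_assoc, ← hQdef, trace]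
    simp
  have hQtr : Q.trace = P.trace := by
    rw [hQdef, trace_mul_comm, ← Matrix.mul_assoc, h2, Matrix.one_mul]
  have hre : (A * P).trace.re = ∑ i, (Q (e.symm i) (e.symm i)).re * x i := by
    rw [htr, Complex.re_sum, ← e.sum_comp]
    refine Finset.sum_congr rfl fun i _ => ?_
    rw [Complex.re_ofReal_mul, e.symm_apply_apply, mul_comm]
  rw [hre]
  refine sum_mul_le_sum_lt hanti hx0 (fun i => ?_) (fun i => ?_) ?_
  · exact (Complex.le_def.1 hQ.diag_nonneg).1
  · have := (Complex.le_def.1 (hQ1.diag_nonneg (i := e.symm i))).1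
    simpa using this
  · rw [e.symm.sum_comp fun i => (Q i i).re, ← Complex.re_sum]
    exact le_of_eq_of_le (congrArg Complex.re hQtr) hk

/-- `P` is diagonal in an eigenbasis of `A`, with entries `w`. Fractional weights are allowed
because the `repeatDiv` majorization cuts through blocks. -/
theorem HasEigenvalues.exists_effect (hA : A.IsHermitian) {N : ℕ} {x : Fin N → ℝ}
    (hx : HasEigenvalues A x) {w : Fin N → ℝ} (hw0 : ∀ i, 0 ≤ w i) (hw1 : ∀ i, w i ≤ 1) :
    ∃ P : Matrix ι ι ℂ, P.PosSemidef ∧ (1 - P).PosSemidef ∧ P.trace = (∑ i, w i : ℝ) ∧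
      (A * P).trace = (∑ i, w i * x i : ℝ) := by
  obtain ⟨W, e, h1, h2, h3⟩ := hx.exists_unitary hA
  refine ⟨W * diagonal (fun i => (w (e i) : ℂ)) * Wᴴ, posSemidef_conj_diagonal W fun i => hw0 _,
    ?_, ?_, ?_⟩
  · rw [one_sub_conj_diagonal h2]
    exact posSemidef_conj_diagonal W fun i => sub_nonneg.2 (hw1 _)
  · rw [trace_conj_diagonal h1, e.sum_comp fun i => (w i : ℂ)]
    push_cast; rfl
  · rw [h3, conj_diagonal_mul h1, trace_conj_diagonal h1,
      e.sum_comp fun i => (x i : ℂ) * (w i : ℂ)]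
    push_cast
    exact Finset.sum_congr rfl fun i _ => mul_comm _ _

/-- The support projection of a Hermitian matrix. -/
theorem exists_support_projection (hA : A.IsHermitian) :
    ∃ P : Matrix ι ι ℂ, P.PosSemidef ∧ (1 - P).PosSemidef ∧ P.trace = A.rank ∧ A * P = A := by
  obtain ⟨W, h1, h2, h3⟩ := exists_unitary_diagonal hA
  let w : ι → ℝ := fun i => if hA.eigenvalues i ≠ 0 then 1 else 0
  refine ⟨W * diagonal (fun i => (w i : ℂ)) * Wᴴ, posSemidef_conj_diagonal W fun i => ?_,
    ?_, ?_, ?_⟩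
  · dsimp only [w]; split_ifs <;> norm_num
  · rw [one_sub_conj_diagonal h2]
    refine posSemidef_conj_diagonal W fun i => ?_
    dsimp only [w]; split_ifs <;> norm_num
  · rw [trace_conj_diagonal h1, hA.rank_eq_card_non_zero_eigs, Fintype.card_subtype]
    simp [w, ← Finset.sum_boole, apply_ite]
  · have hwd : ∀ i, (hA.eigenvalues i : ℂ) * (w i : ℂ) = hA.eigenvalues i := fun i => by
      by_cases h : hA.eigenvalues i = 0 <;> simp [w, h]
    conv_lhs => rw [h3, conj_diagonal_mul h1]
    simp_rw [hwd]
    exact h3.symm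

end Spectral

/-! ### Spectral inequalities for the partial trace and construction of states. -/

section PartialTrace

variable {m n : ℕ}

theorem trace_mul_one_kronecker (ρ : Matrix (Fin m × Fin n) (Fin m × Fin n) ℂ)
    (P : Matrix (Fin n) (Fin n) ℂ) :
    (ρ * kroneckerMap (· * ·) (1 : Matrix (Fin m) (Fin m) ℂ) P).trace
      = (partialTraceFst ρ * P).trace := by
  simp only [trace, diag_apply, mul_apply, Fintype.sum_prod_type, kroneckerMap_apply, one_apply,
    partialTraceFst, of_apply, ite_mul, one_mul, zero_mul, mul_ite, mul_zero, Finset.sum_mul]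
  rw [Finset.sum_comm]
  refine Finset.sum_congr rfl fun a _ => ?_
  rw [Finset.sum_comm' (t' := Finset.univ) (s' := fun _ => Finset.univ) (by simp)]
  conv_rhs => rw [Finset.sum_comm]
  rw [Finset.sum_comm]
  refine Finset.sum_congr rfl fun i _ => ?_
  rw [Finset.sum_comm]
  simp

/-- Ky Fan's bound for `ρ` against `1 ⊗ P`, whose trace is `m * ∑ w`; the source of the first two
majorizations. -/
theorem sum_mul_le_of_partialTraceFst {ρ : Matrix (Fin m × Fin n) (Fin m × Fin n) ℂ}
    (hρ : ρ.IsHermitian) (hσ : (partialTraceFst ρ).IsHermitian)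
    {lam : Fin n → ℝ} {mu : Fin (m * n) → ℝ} (hlam : HasEigenvalues (partialTraceFst ρ) lam)
    (hmu : HasEigenvalues ρ mu) (hanti : Antitone mu) (hmu0 : ∀ i, 0 ≤ mu i)
    {w : Fin n → ℝ} (hw0 : ∀ i, 0 ≤ w i) (hw1 : ∀ i, w i ≤ 1) {k : ℕ}
    (hk : m * ∑ i, w i ≤ (k : ℝ)) :
    ∑ i, w i * lam i ≤ ∑ i with i.val < k, mu i := by
  obtain ⟨P, hP, hP1, htr, hAP⟩ := hlam.exists_effect hσ hw0 hw1
  have hsub : 1 - kroneckerMap (· * ·) (1 : Matrix (Fin m) (Fin m) ℂ) P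
      = kroneckerMap (· * ·) (1 : Matrix (Fin m) (Fin m) ℂ) (1 - P) := by
    ext ⟨i, a⟩ ⟨j, b⟩
    rcases eq_or_ne i j with rfl | hij
    · simp [one_apply]
    · simp [one_apply, hij]
  have := hmu.re_trace_mul_le hρ hanti hmu0 (PosSemidef.one.kronecker hP)
    (hsub ▸ PosSemidef.one.kronecker hP1) (k := k) (by
      rw [trace_kronecker, htr, trace_one, Fintype.card_fin]
      simpa using hk)
  rwa [trace_mul_one_kronecker, hAP, Complex.ofReal_re] at this

theorem sum_lt_le_of_partialTraceFst {ρ : Matrix (Fin m × Fin n) (Fin m × Fin n) ℂ}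
    (hρ : ρ.IsHermitian) (hσ : (partialTraceFst ρ).IsHermitian)
    {lam : Fin n → ℝ} {mu : Fin (m * n) → ℝ} (hlam : HasEigenvalues (partialTraceFst ρ) lam)
    (hmu : HasEigenvalues ρ mu) (hanti : Antitone lam) (hlam0 : ∀ i, 0 ≤ lam i)
    (hmu0 : ∀ i, 0 ≤ mu i) (k : ℕ) :
    ∑ i with i.val < k, mu i ≤ ∑ a with a.val < k * m, lam a := by
  obtain ⟨W, e, h1, h2, h3⟩ := hmu.exists_unitary hρ
  -- Each weighted eigenvector is reshaped into an `n × m` block, so `B * Bᴴ` is the partial trace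
  -- of the part of `ρ` with index below `k`, and `C * Cᴴ` that of the rest. Counting columns of `B`
  -- bounds the rank by `k * m`.
  let B : Matrix (Fin n) (Fin m × {i // (e i).val < k}) ℂ :=
    fun a p => (Real.sqrt (mu (e p.2)) : ℂ) * W (p.1, a) p.2
  let C : Matrix (Fin n) (Fin m × {i // ¬ (e i).val < k}) ℂ :=
    fun a p => (Real.sqrt (mu (e p.2)) : ℂ) * W (p.1, a) p.2
  have hB : ∀ a p, B a p = (Real.sqrt (mu (e p.2)) : ℂ) * W (p.1, a) p.2 := fun _ _ => rfl
  have hC : ∀ a p, C a p = (Real.sqrt (mu (e p.2)) : ℂ) * W (p.1, a) p.2 := fun _ _ => rfl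
  have hsq : ∀ i, (Real.sqrt (mu i) : ℂ) * Real.sqrt (mu i) = mu i := fun i => by
    rw [← Complex.ofReal_mul, Real.mul_self_sqrt (hmu0 i)]
  have hterm : ∀ (i : Fin m × Fin n) (z w : ℂ), (Real.sqrt (mu (e i)) : ℂ) * z *
      (starRingEnd ℂ) ((Real.sqrt (mu (e i)) : ℂ) * w) = mu (e i) * (z * (starRingEnd ℂ) w) := by
    intro i z w
    rw [← hsq, map_mul, Complex.conj_ofReal]
    ring
  have hdecomp : partialTraceFst ρ = B * Bᴴ + C * Cᴴ := by
    ext a b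
    rw [partialTraceFst, of_apply, Matrix.add_apply, mul_apply, mul_apply, Fintype.sum_prod_type, Fintype.sum_prod_type,
      ← Finset.sum_add_distrib]
    refine Finset.sum_congr rfl fun j _ => ?_
    simp only [hB, hC, conjTranspose_apply, RCLike.star_def, hterm]
    refine Eq.trans ?_ (Fintype.sum_subtype_add_sum_subtype (fun i => (e i).val < k)
      fun i => (mu (e i) : ℂ) * (W (j, a) i * (starRingEnd ℂ) (W (j, b) i))).symm
    conv_lhs => rw [h3, mul_apply]
    refine Finset.sum_congr rfl fun i _ => ?_
    rw [mul_diagonal, conjTranspose_apply, RCLike.star_def]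
    ring
  have htrB : (B * Bᴴ).trace = (∑ i with i.val < k, mu i : ℝ) := by
    rw [trace]
    simp only [diag_apply, mul_apply, conjTranspose_apply, RCLike.star_def, hB, hterm]
    rw [Finset.sum_comm, Fintype.sum_prod_type, Finset.sum_comm]
    have hcol : ∀ i, ∑ j, ∑ a, (W (j, a) i * (starRingEnd ℂ) (W (j, a) i)) = 1 := fun i => by
      have := congrFun (congrFun h1 i) i
      rw [mul_apply, Fintype.sum_prod_type, one_apply_eq] at this
      rw [← this]
      refine Finset.sum_congr rfl fun j _ => Finset.sum_congr rfl fun a _ => ?_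
      rw [conjTranspose_apply, RCLike.star_def, mul_comm]
    simp_rw [← Finset.mul_sum, hcol, mul_one]
    rw [← Finset.sum_subtype_eq_sum_filter, Finset.subtype_univ]
    push_cast
    exact (e.subtypeEquiv fun i => Iff.rfl).sum_comp fun i : {i : Fin (m * n) // i.val < k} =>
      (mu i : ℂ)
  have hrank : (B * Bᴴ).rank ≤ k * m := by
    rw [rank_self_mul_conjTranspose]
    refine B.rank_le_card_width.trans ?_
    rw [Fintype.card_prod, Fintype.card_fin, Nat.mul_comm]
    refine Nat.mul_le_mul_right _ ?_
    have : Function.Injective fun i : {i // (e i).val < k} => (⟨(e i).val, i.2⟩ : Fin k) :=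
      fun i j h => Subtype.ext (e.injective (Fin.ext (Fin.mk.inj_iff.1 h)))
    simpa using Fintype.card_le_of_injective _ this
  obtain ⟨Q, hQ, hQ1, hQtr, hBQ⟩ :=
    exists_support_projection (posSemidef_self_mul_conjTranspose B).isHermitian
  have hle := hlam.re_trace_mul_le hσ hanti hlam0 hQ hQ1 (k := k * m) (by
    rw [hQtr, Complex.natCast_re]
    exact_mod_cast hrank)
  -- The rest contributes nonnegatively, so it can be dropped from the bound.
  have hCQ : 0 ≤ (C * Cᴴ * Q).trace.re := by
    rw [Matrix.mul_assoc, trace_mul_comm]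
    exact (Complex.le_def.1 (hQ.conjTranspose_mul_mul_same C).trace_nonneg).1
  rw [hdecomp, Matrix.add_mul, trace_add, hBQ, htrB, Complex.add_re, Complex.ofReal_re] at hle
  linarith

theorem exists_state_of_isDiagonalOfConj (hnm : n ≤ m) (hm : m ≠ 0) {mu : Fin (m * n) → ℝ}
    {lam : Fin n → ℝ} (hmu0 : ∀ i, 0 ≤ mu i)
    (h : IsDiagonalOfConj (fun a : Fin n => blockSum m mu a) lam) :
    ∃ ρ : Matrix (Fin m × Fin n) (Fin m × Fin n) ℂ, ρ.PosSemidef ∧ HasEigenvalues ρ mu ∧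
      partialTraceFst ρ = diagonal fun a => (lam a : ℂ) := by
  obtain ⟨U, hU, hd⟩ := h
  have : NeZero m := ⟨hm⟩
  have hU' : ∀ a a', ∑ c, U c a * U c a' = if a = a' then 1 else 0 := fun a a' => by
    have := congrFun (congrFun (mul_eq_one_comm.1 hU : Uᵀ * U = 1) a) a'
    simpa [mul_apply, one_apply] using this
  -- Column `(i, a)` is `∑ c, U c a • e (i + c) ⊗ e c`; addition in `Fin m` is cyclic.
  let W : Matrix (Fin m × Fin n) (Fin m × Fin n) ℂ :=
    fun p q => if p.1 = q.1 + Fin.castLE hnm p.2 then (U p.2 q.2 : ℂ) else 0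
  have hWp : ∀ p q, W p q = if p.1 = q.1 + Fin.castLE hnm p.2 then (U p.2 q.2 : ℂ) else 0 :=
    fun _ _ => rfl
  clear_value W
  have hW : Wᴴ * W = 1 := by
    ext ⟨i, a⟩ ⟨i', a'⟩
    rw [mul_apply, Fintype.sum_prod_type, Finset.sum_comm]
    have hc : ∀ c : Fin n, ∑ p : Fin m, Wᴴ (i, a) (p, c) * W (p, c) (i', a')
        = if i = i' then ((U c a * U c a' : ℝ) : ℂ) else 0 := fun c => by
      rw [Finset.sum_eq_single (i + Fin.castLE hnm c)]
      · simp only [hWp, conjTranspose_apply, if_true, add_left_inj]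
        split_ifs <;> simp
      · intro p _ hp
        simp [hWp, hp]
      · simp
    simp_rw [hc]
    rcases eq_or_ne i i' with rfl | hi
    · simp only [if_true]
      rw [← Complex.ofReal_sum, hU']
      simp [one_apply, apply_ite]
    · simp [hi, one_apply]
  refine ⟨W * diagonal (fun i => (mu (blockEquiv m n i) : ℂ)) * Wᴴ,
    posSemidef_conj_diagonal W fun i => hmu0 _, hasEigenvalues_conj_diagonal hW mu _, ?_⟩
  ext c c'
  simp only [partialTraceFst, of_apply]
  simp_rw [mul_apply (M := W * _), mul_diagonal]
  rw [Finset.sum_comm]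
  have hq : ∀ q : Fin m × Fin n, ∑ p : Fin m, W (p, c) q * (mu (blockEquiv m n q) : ℂ) *
      Wᴴ q (p, c') = if c = c' then ((U c q.2 ^ 2 * mu (blockEquiv m n q) : ℝ) : ℂ) else 0 :=
    fun q => by
      rw [Finset.sum_eq_single (q.1 + Fin.castLE hnm c)]
      · rcases eq_or_ne c c' with rfl | hcc
        · simp [hWp]; ring
        -- Here `n ≤ m` matters: distinct `c` land in distinct first coordinates, which kills the
        -- off-diagonal entries.
        · have : Fin.castLE hnm c ≠ Fin.castLE hnm c' := fun h => hcc (Fin.castLE_injective hnm h)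
          simp [hWp, hcc, this]
      · intro p _ hp
        simp [hWp, hp]
      · simp
  simp_rw [hq]
  rcases eq_or_ne c c' with rfl | hcc
  · simp only [if_true, diagonal_apply_eq]
    rw [← Complex.ofReal_sum, ← hd c, Fintype.sum_prod_type, Finset.sum_comm]
    simp_rw [blockSum_eq_sum_blockEquiv, Finset.mul_sum]
  · simp [hcc]

theorem trace_partialTraceFst (ρ : Matrix (Fin m × Fin n) (Fin m × Fin n) ℂ) :
    (partialTraceFst ρ).trace = ρ.trace := by
  simp only [trace, diag_apply, partialTraceFst, of_apply, Fintype.sum_prod_type]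
  exact Finset.sum_comm

end PartialTrace

/-! ### Derivation of the majorizations and the final assembly. -/

theorem repeatDiv_majorizedBy {m n : ℕ} (hm : m ≠ 0) {lam : Fin n → ℝ} {mu : Fin (m * n) → ℝ}
    (hlam : Antitone lam) (hmu : Antitone mu) (hsum : ∑ i, lam i = ∑ i, mu i)
    (hle : ∀ (w : Fin n → ℝ) (k : ℕ), (∀ i, 0 ≤ w i) → (∀ i, w i ≤ 1) →
      m * ∑ i, w i ≤ (k : ℝ) → ∑ i, w i * lam i ≤ ∑ i with i.val < k, mu i) :
    MajorizedBy (repeatDiv m lam) mu := by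
  have hm' : (0 : ℝ) < m := by positivity
  refine ⟨(sum_repeatDiv hm lam).trans hsum, fun k _ hk => ?_⟩
  rw [sumLargest_of_antitone (repeatDiv_antitone m hlam), sumLargest_of_antitone hmu]
  -- The fraction of block `a` lying among the first `k` positions, so that `m * ∑ w = k`.
  let w : Fin n → ℝ := fun a =>
    (∑ i : Fin m, if (blockEquiv m n (i, a)).val < k then (1 : ℝ) else 0) / m
  have heq : ∑ i with i.val < k, repeatDiv m lam i = ∑ a, w a * lam a := by
    rw [Finset.sum_filter, ← (blockEquiv m n).sum_comp, Fintype.sum_prod_type, Finset.sum_comm]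
    refine Finset.sum_congr rfl fun a _ => ?_
    simp only [repeatDiv_blockEquiv, w]
    rw [div_mul_eq_mul_div, mul_div_assoc, Finset.sum_mul]
    simp only [ite_mul, one_mul, zero_mul]
  rw [heq]
  refine hle w k (fun a => ?_) (fun a => ?_) ?_
  · exact div_nonneg (Finset.sum_nonneg fun i _ => by split_ifs <;> norm_num) hm'.le
  · rw [div_le_one hm']
    refine (Finset.sum_le_sum (g := fun _ => (1 : ℝ)) fun i _ => ?_).trans (by simp)
    split_ifs <;> norm_num
  · simp only [w]
    rw [← Finset.sum_div, mul_div_cancel₀ _ hm'.ne', Finset.sum_comm,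
      ← Fintype.sum_prod_type' (f := fun i a =>
        if (blockEquiv m n (i, a)).val < k then (1 : ℝ) else 0),
      (blockEquiv m n).sum_comp fun i => if i.val < k then (1 : ℝ) else 0, ← Finset.sum_filter,
      sum_lt_eq_sum_range (fun _ => 1) hk.le]
    simp

end ReducedState

open ReducedState Matrix in
theorem theorem4p1 (m n : ℕ) (hm : 2 ≤ m) (hn : 2 ≤ n)
    (lam : Fin n → ℝ) (mu : Fin (m * n) → ℝ)
    (hlam : Antitone lam) (hmu : Antitone mu)
    (hlam0 : ∀ i, 0 ≤ lam i) (hmu0 : ∀ i, 0 ≤ mu i)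
    (hlam1 : ∑ i, lam i = 1) (hmu1 : ∑ i, mu i = 1) :
    ((∃ σ ∈ ReducedState.densityMatrices (Fin n), ReducedState.HasEigenvalues σ lam ∧
        ∃ ρ ∈ ReducedState.statesWithReduction m σ, ReducedState.HasEigenvalues ρ mu) →
      ReducedState.MajorizedBy (ReducedState.repeatDiv m lam) mu ∧
      ReducedState.MajorizedBy lam (fun k : Fin n => ReducedState.blockSum m mu k) ∧
      ReducedState.MajorizedBy mu (fun k : Fin (m * n) => ReducedState.blockSum m lam k)) ∧
    (n ≤ m → ReducedState.MajorizedBy lam (fun k : Fin n => ReducedState.blockSum m mu k) →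
      ∃ σ ∈ ReducedState.densityMatrices (Fin n), ReducedState.HasEigenvalues σ lam ∧
        ∃ ρ ∈ ReducedState.statesWithReduction m σ, ReducedState.HasEigenvalues ρ mu) := by
  have hm0 : m ≠ 0 := by omega
  have hsum := hlam1.trans hmu1.symm
  have hsumBlock : ∑ i, lam i = ∑ k : Fin n, blockSum m mu k := by
    rw [sum_blockSum m mu (Nat.mul_comm m n).le, hsum]
  constructor
  · rintro ⟨_, ⟨hσ, -⟩, hσlam, ρ, ⟨⟨hρ, -⟩, rfl⟩, hρmu⟩
    have hle := fun (w : Fin n → ℝ) (k : ℕ) h0 h1 h => sum_mul_le_of_partialTraceFst (k := k)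
      hρ.isHermitian hσ.isHermitian hσlam hρmu hmu hmu0 (w := w) h0 h1 h
    refine ⟨repeatDiv_majorizedBy hm0 hlam hmu hsum hle, ⟨hsumBlock, fun k _ hk => ?_⟩, ?_, ?_⟩
    · rw [sumLargest_of_antitone hlam, sumLargest_blockSum m hmu hmu0 hk.le]
      have := hle (fun a => if a.val < k then 1 else 0) (k * m)
        (fun a => by split_ifs <;> norm_num)
        (fun a => by split_ifs <;> norm_num) (by
          rw [← Finset.sum_filter, sum_lt_eq_sum_range (fun _ => 1) hk.le]
          simp [mul_comm])
      simpa [Finset.sum_filter] using this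
    · rw [sum_blockSum m lam (by nlinarith [Nat.zero_le n, Nat.mul_le_mul hm hm]), hsum]
    · intro k _ hk
      rw [sumLargest_of_antitone hmu, sumLargest_blockSum m hlam hlam0 hk.le]
      exact sum_lt_le_of_partialTraceFst hρ.isHermitian hσ.isHermitian hσlam hρmu hlam hlam0 hmu0 k
  · rintro hnm ⟨-, hmaj⟩
    have hdiag : IsDiagonalOfConj (fun a : Fin n => blockSum m mu a) lam := by
      refine (IsDiagonalOfConj.refl _).of_sum_lt_le hlam hsumBlock fun k => ?_
      -- Majorization covers only `1 ≤ k < n`; the remaining `k` are trivial or follow from equality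
      -- of the total sums.
      rcases Nat.eq_zero_or_pos k with rfl | hk0
      · simp
      rcases lt_or_ge k n with hk | hk
      · have := hmaj k hk0 hk
        rwa [sumLargest_of_antitone hlam,
          sumLargest_of_antitone fun a b h => blockSum_antitone m hmu hmu0 h] at this
      · rw [Finset.filter_true_of_mem fun i _ => i.isLt.trans_le hk]
        exact hsumBlock.le
    obtain ⟨ρ, hρ, hρmu, hρlam⟩ := exists_state_of_isDiagonalOfConj hnm hm0 hmu0 hdiag
    have htr : (diagonal fun a => (lam a : ℂ)).trace = 1 := by
      rw [trace_diagonal, ← Complex.ofReal_sum, hlam1, Complex.ofReal_one]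
    refine ⟨diagonal fun a => (lam a : ℂ),
      ⟨PosSemidef.diagonal fun i => by simpa using hlam0 i, htr⟩, ?_, ρ,
      ⟨⟨hρ, ?_⟩, hρlam⟩, hρmu⟩
    · simpa using hasEigenvalues_conj_diagonal (W := (1 : Matrix (Fin n) (Fin n) ℂ)) (by simp) lam
        (Equiv.refl _)
    · rw [← trace_partialTraceFst, hρlam, htr]
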